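/- **Setting.** Let $\mathcal A$ be a finite set of scenarios, let $X\subseteq\mathbb R_{\ge 0}^m$ be a finite set of first-stage actions with $0\in X$, let $c\in\mathbb R_{\ge 0}^m$ be first-stage costs, and let $g(x,A)$ be the optimal second-stage cost of scenario $A\in\mathcal A$ under the first-stage decision $x$. Let $\ell:\mathcal A\times\mathcal A\to\mathbb R_{\ge 0}$ be a scenario metric; only $\ell\ge 0$ and $\ell(A,A)=0$ are required, so asymmetric metrics and pseudometrics are allowed. Let $r\ge 0$. For probability distributions $p,q$ on $\mathcal A$, the Wasserstein distance $L_W(p,q)$ is the minimum of $\sum_{A,A'}\gamma_{A,A'}\,\ell(A,A')$ over all $\gamma\in\mathbb R_{\ge0}^{\mathcal A\times\mathcal A}$ with $\sum_{A'}\gamma_{A,A'}=p_A$ for all $A$ and $\sum_{A}\gamma_{A,A'}=q_{A'}$ for all $A'$. For a central distribution $p$ put $$h(p;x)=c^{\mathsf T}x+\max_{q:\,L_W(p,q)\le r}\ \mathbb E_{A\sim q}[g(x,A)],\qquad \mathrm{OPT}(p)=\min_{x\in X}h(p;x).$$ Assume that there are $\lambda\ge 1$ and $\tau\ge 1$ such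 that, for all $x\in X$ and $A,A'\in\mathcal A$: $0\le g(x,A)\le g(0,A)$; $g(0,A)\le g(x,A)+\lambda c^{\mathsf T}x$; and $g(x,A')-g(x,A)\le\tau\,\ell(A,A')$ whenever $\ell(A,A')>0$. **Theorem.** There are an absolute constant $C\ge 0$ and a polynomial $P$ in four variables (both independent of the problem and of all parameters below) such that the following holds for every such problem, every probability distribution $\mathring p$ on $\mathcal A$, and all $0<\varepsilon\le\frac13$, $0<\delta<1$, $\kappa>0$, $\beta\ge 1$, $\rho\ge1$. Let $k=\bigl\lceil\frac2\varepsilon\log\frac1\delta\bigr\rceil$ and let $N$ be any natural number with $$N\ \ge\ P\Bigl(\tfrac\lambda\varepsilon,\ \log|X|,\ \log\tfrac\tau\kappa,\ \log\tfrac1\delta\Bigr).$$ Draw $kN$ independent samples from $\mathring p$ and let $\hat p^1,\dots,\hat p^k$ be the empirical distributions of $k$ disjoint groups of $N$ samples each. Then, with probability at least $1-3\delta$ over the samples, the following holds. For all $\hat x^1,\dots,\hat x^k\in X$ and $f^1,\dots,f^k\in\mathbb R$ (which may depend on the samples in any way) such that, for every $i=1,\dots,k$, $$\text{(S1)}\quad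 h(\hat p^i;\hat x^i)\le\beta f^i,\qquad\qquad \text{(S2)}\quad f^i\le\rho\cdot\mathrm{OPT}(\hat p^i),$$ and for every index $j$ with $f^j=\min_{i}f^i$, the point $\hat x=\hat x^j$ satisfies $$h(\mathring p;\hat x)\ \le\ 4\beta\rho\,(1+C\varepsilon)\,\mathrm{OPT}(\mathring p)+2\beta\rho\kappa.$$ -/

import Mathlib

open MeasureTheory ProbabilityTheory

/-- The transportation plans from `p` to `q`: nonnegative `γ` with marginals `p` and `q`. -/
def transportPlans {A : Type*} [Fintype A] (p q : A → ℝ) : Set (A → A → ℝ) :=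
  {γ | (∀ a b, 0 ≤ γ a b) ∧ (∀ a, ∑ b, γ a b = p a) ∧ (∀ b, ∑ a, γ a b = q b)}

/-- The Wasserstein distance from `p` to `q` with respect to the scenario (pseudo)metric `d`: the
minimum cost of a transportation plan from `p` to `q`. -/
noncomputable def wasserstein {A : Type*} [Fintype A] (d : A → A → ℝ) (p q : A → ℝ) : ℝ :=
  sInf ((fun γ : A → A → ℝ => ∑ a, ∑ b, γ a b * d a b) '' transportPlans p q)

/-- The data of a distributionally robust two-stage problem with scenario set `A`, apart from the
central distribution: finite first-stage action set `X`, first-stage costs `c`, optimal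
second-stage cost `g x a` of scenario `a` given the first-stage decision `x`, scenario metric
`dist` and radius `r` of the Wasserstein ball. -/
structure DRProblem (m : ℕ) (A : Type*) where
  X : Finset (Fin m → ℝ)
  c : Fin m → ℝ
  g : (Fin m → ℝ) → A → ℝ
  dist : A → A → ℝ
  r : ℝ

namespace DRProblem

variable {m : ℕ} {A : Type*}

/-- The standing assumptions on the problem, with inflation parameter `lam` and parameter `τ`
relating the second-stage costs to the scenario metric. No symmetry, triangle inequality or
separation is asked of `dist`, so that metrics, asymmetric metrics and pseudometrics are all
covered. -/
structure IsAdmissible (Q : DRProblem m A) (lam τ : ℝ) : Prop where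
  dist_nonneg : ∀ a b, 0 ≤ Q.dist a b
  dist_self : ∀ a, Q.dist a a = 0
  r_nonneg : 0 ≤ Q.r
  X_nonneg : ∀ x ∈ Q.X, 0 ≤ x
  zero_mem : 0 ∈ Q.X
  c_nonneg : 0 ≤ Q.c
  g_nonneg : ∀ x ∈ Q.X, ∀ a, 0 ≤ Q.g x a
  g_le : ∀ x ∈ Q.X, ∀ a, Q.g x a ≤ Q.g 0 a
  one_le_lam : 1 ≤ lam
  inflation : ∀ x ∈ Q.X, ∀ a, Q.g 0 a ≤ Q.g x a + lam * (Q.c ⬝ᵥ x)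
  one_le_tau : 1 ≤ τ
  lipschitz : ∀ x ∈ Q.X, ∀ a b, 0 < Q.dist a b → Q.g x b - Q.g x a ≤ τ * Q.dist a b

variable [Fintype A]

/-- The probability distributions `q` on `A` with Wasserstein distance at most `r` from `p`. -/
def ball (Q : DRProblem m A) (p : A → ℝ) : Set (A → ℝ) :=
  {q | q ∈ stdSimplex ℝ A ∧ wasserstein Q.dist p q ≤ Q.r}

/-- The worst-case expected second-stage cost of `x`, for the central distribution `p`. -/
noncomputable def z (Q : DRProblem m A) (p : A → ℝ) (x : Fin m → ℝ) : ℝ :=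
  sSup ((fun q : A → ℝ => ∑ a, q a * Q.g x a) '' Q.ball p)

/-- The objective function `h(p; x)` for the central distribution `p`. -/
noncomputable def h (Q : DRProblem m A) (p : A → ℝ) (x : Fin m → ℝ) : ℝ :=
  Q.c ⬝ᵥ x + Q.z p x

/-- The optimal value `min_{x ∈ X} h(p; x)` for the central distribution `p`. -/
noncomputable def opt (Q : DRProblem m A) (p : A → ℝ) : ℝ :=
  sInf (Q.h p '' (Q.X : Set (Fin m → ℝ)))

end DRProblem

/-- The empirical distribution of the samples `s 0, …, s (N - 1)`. -/
noncomputable def empirical {A : Type*} [DecidableEq A] {N : ℕ} (s : Fin N → A) (a : A) : ℝ :=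
  ((Finset.univ.filter fun n => s n = a).card : ℝ) / N

/-!
By linear programming duality, the worst-case expectation `Q.z p x` is the infimum over prices
`y ≥ 0` of `r y + ∑ a, p a * G x y a`, where `G x y a = max_b (g x b - y d a b)` is `dualLoss`
(`DRProblem.IsAdmissible.z_le_dual`, `DRProblem.IsAdmissible.exists_dual_le`). For each fixed `y`
this is an ordinary two-stage problem that inherits the inflation bound
`G 0 y ≤ G x y + lam * (c ⬝ᵥ x)`, and `G x y a` is antitone in `y`.

Fix an optimal action `x₀` for `p` and a price `y₀` that is optimal for it up to `η = κ / 2`, and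
put `B = opt p + η`. Call a scenario expensive if `G 0 y₀ a` exceeds `lam * B / ε`.

* By Markov's inequality in independent groups, with probability at least `1 - δ` some group `i` has
  `opt (p̂ i) ≤ (1 + ε) B`, through the feasible dual pair `(x₀, y₀)`
  (`measure_forall_lt_empirical_mean_le`). Since `f j` is minimal, this gives
  `h (p̂ j; x̂ j) ≤ β ρ (1 + ε) B`.
* On cheap scenarios and for `y ≥ y₀` the losses lie in `[0, lam * B / ε]`, so Hoeffding's
  inequality, with a union bound over groups, actions and a grid of about `lam / ε ^ 2` prices,
  bounds the true means by the empirical means plus `2 ε B` with probability at least `1 - δ`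
  (`DRProblem.IsAdmissible.measure_exists_lowLoss_lt`). The grid consists of the last points of
  level sets of the mean as a function of the price, which is why its size does not depend on `τ`
  or `κ`.
* Expensive scenarios carry probability at most about `ε / lam`, so by inflation they and `r y₀`
  cost at most `B` in total even for the action `0`
  (`DRProblem.IsAdmissible.budget_add_high_le`).

Raising a dual optimal price for `p̂ j` to at least `y₀` costs at most `r y₀` more and lets all three
estimates apply: `h (p; x̂) ≤ h (p̂ j; x̂) + 2 ε B + B + η`
(`DRProblem.IsAdmissible.h_le_of_lowLoss_le`). Altogether
`h (p; x̂) ≤ β ρ ((2 + 3 ε) B + η) ≤ β ρ (3 opt p + 2 κ)`, so the constant `C = 0` suffices.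
-/

/-! ### The dual loss -/

/-- For a price `y` per unit of transport, the largest value of `f b - y * d a b` over all targets
`b`: the loss of scenario `a` in the Lagrangian dual of the worst-case expectation. -/
noncomputable def dualLoss {A : Type*} (d : A → A → ℝ) (f : A → ℝ) (y : ℝ) (a : A) : ℝ :=
  ⨆ b, (f b - y * d a b)

lemma dualLoss_le {A : Type*} {d : A → A → ℝ} {f : A → ℝ} {y t : ℝ} {a : A}
    (h : ∀ b, f b - y * d a b ≤ t) : dualLoss d f y a ≤ t :=
  have : Nonempty A := ⟨a⟩
  ciSup_le h

section DualLoss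

variable {A : Type*} [Fintype A] {d : A → A → ℝ} {f : A → ℝ}

lemma le_dualLoss (d : A → A → ℝ) (f : A → ℝ) (y : ℝ) (a b : A) :
    f b - y * d a b ≤ dualLoss d f y a :=
  le_ciSup (f := fun b => f b - y * d a b) (Set.finite_range _).bddAbove b

lemma exists_dualLoss_eq (d : A → A → ℝ) (f : A → ℝ) (y : ℝ) (a : A) :
    ∃ b, f b - y * d a b = dualLoss d f y a :=
  have : Nonempty A := ⟨a⟩
  exists_eq_ciSup_of_finite

lemma self_le_dualLoss (hd : ∀ a, d a a = 0) (y : ℝ) (a : A) : f a ≤ dualLoss d f y a := by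
  simpa [hd] using le_dualLoss d f y a a

lemma dualLoss_antitone (hd : ∀ a b, 0 ≤ d a b) (a : A) : Antitone fun y => dualLoss d f y a :=
  fun y _ h => dualLoss_le fun b =>
    (sub_le_sub_left (mul_le_mul_of_nonneg_right h (hd a b)) _).trans (le_dualLoss d f y a b)

lemma continuous_dualLoss (d : A → A → ℝ) (f : A → ℝ) (a : A) :
    Continuous fun y => dualLoss d f y a := by
  have : Nonempty A := ⟨a⟩
  have : (fun y => dualLoss d f y a)
      = fun y => Finset.univ.sup' Finset.univ_nonempty fun b => f b - y * d a b := by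
    funext y
    rw [Finset.sup'_univ_eq_ciSup]
    rfl
  rw [this]
  exact Continuous.finset_sup'_apply _ fun b _ => by fun_prop

lemma dualLoss_mono {f' : A → ℝ} (h : ∀ b, f b ≤ f' b) (y : ℝ) (a : A) :
    dualLoss d f y a ≤ dualLoss d f' y a :=
  dualLoss_le fun b => (sub_le_sub_right (h b) _).trans (le_dualLoss d f' y a b)

lemma dualLoss_le_add {f' : A → ℝ} {t : ℝ} (h : ∀ b, f' b ≤ f b + t) (y : ℝ) (a : A) :
    dualLoss d f' y a ≤ dualLoss d f y a + t :=
  dualLoss_le fun b => by linarith [h b, le_dualLoss d f y a b]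

/-- If `f` is `τ`-Lipschitz along all pairs at positive distance, then prices above `τ` are no more
effective than `τ` itself. -/
lemma dualLoss_min (hd : ∀ a b, 0 ≤ d a b) (hd0 : ∀ a, d a a = 0) {τ : ℝ}
    (hf : ∀ a b, 0 < d a b → f b - f a ≤ τ * d a b) (y : ℝ) (a : A) :
    dualLoss d f (min y τ) a = dualLoss d f y a := by
  refine le_antisymm ?_ (dualLoss_antitone hd a (min_le_left _ _))
  rcases le_total y τ with h | h
  · rw [min_eq_left h]
  rw [min_eq_right h]
  refine dualLoss_le fun b => ?_
  rcases (hd a b).eq_or_lt with h0 | h0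
  · simpa [← h0] using le_dualLoss d f y a b
  · linarith [hf a b h0, self_le_dualLoss (f := f) hd0 y a]

end DualLoss

/-! ### Transport plans -/

section Transport

variable {A : Type*} [Fintype A]

lemma transportPlans_prod {p q : A → ℝ} (hp : p ∈ stdSimplex ℝ A) (hq : q ∈ stdSimplex ℝ A) :
    (fun a b => p a * q b) ∈ transportPlans p q := by
  refine ⟨fun a b => mul_nonneg (hp.1 a) (hq.1 b), fun a => ?_, fun b => ?_⟩
  · rw [← Finset.mul_sum, hq.2, mul_one]
  · rw [← Finset.sum_mul, hp.2, one_mul]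

lemma transportPlans_cost_nonneg {d : A → A → ℝ} (hd : ∀ a b, 0 ≤ d a b) {p q : A → ℝ}
    {γ : A → A → ℝ} (hγ : γ ∈ transportPlans p q) : 0 ≤ ∑ a, ∑ b, γ a b * d a b :=
  Finset.sum_nonneg fun a _ => Finset.sum_nonneg fun b _ => mul_nonneg (hγ.1 a b) (hd a b)

lemma wasserstein_le_cost {d : A → A → ℝ} (hd : ∀ a b, 0 ≤ d a b) {p q : A → ℝ}
    {γ : A → A → ℝ} (hγ : γ ∈ transportPlans p q) :
    wasserstein d p q ≤ ∑ a, ∑ b, γ a b * d a b := by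
  refine csInf_le ⟨0, ?_⟩ ⟨γ, hγ, rfl⟩
  rintro _ ⟨γ, hγ, rfl⟩
  exact transportPlans_cost_nonneg hd hγ

/-- The plans that move mass out of `p`, with no condition on where it goes. -/
def plansFrom (p : A → ℝ) : Set (A → A → ℝ) :=
  {γ | (∀ a b, 0 ≤ γ a b) ∧ ∀ a, ∑ b, γ a b = p a}

lemma convex_plansFrom (p : A → ℝ) : Convex ℝ (plansFrom p) := by
  intro γ hγ γ' hγ' s t hs ht hst
  refine ⟨fun a b => ?_, fun a => ?_⟩
  · have := hγ.1 a b
    have := hγ'.1 a b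
    simp only [Pi.add_apply, Pi.smul_apply, smul_eq_mul]
    positivity
  · simp only [Pi.add_apply, Pi.smul_apply, smul_eq_mul]
    rw [Finset.sum_add_distrib, ← Finset.mul_sum, ← Finset.mul_sum, hγ.2, hγ'.2, ← add_mul, hst,
      one_mul]

lemma isCompact_plansFrom (p : A → ℝ) : IsCompact (plansFrom p) := by
  refine (isCompact_Icc (a := (0 : A → A → ℝ)) (b := fun a _ => p a)).of_isClosed_subset ?_ ?_
  · refine IsClosed.inter (s₁ := {γ : A → A → ℝ | ∀ a b, 0 ≤ γ a b})
      (s₂ := {γ : A → A → ℝ | ∀ a, ∑ b, γ a b = p a}) ?_ ?_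
    · simp only [Set.ofPred_forall]
      exact isClosed_iInter fun a => isClosed_iInter fun b =>
        isClosed_le continuous_const (by fun_prop)
    · simp only [Set.ofPred_forall]
      exact isClosed_iInter fun a => isClosed_eq (by fun_prop) continuous_const
  · intro γ hγ
    refine ⟨fun a b => hγ.1 a b, fun a b => ?_⟩
    dsimp only
    rw [← hγ.2 a]
    exact Finset.single_le_sum (fun b _ => hγ.1 a b) (Finset.mem_univ b)

end Transport

/-! ### Duality for the worst-case expectation -/

namespace DRProblem

variable {m : ℕ} {A : Type*} [Fintype A] {Q : DRProblem m A} {lam τ : ℝ}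

lemma IsAdmissible.mem_ball_self [DecidableEq A] (hQ : Q.IsAdmissible lam τ) {p : A → ℝ}
    (hp : p ∈ stdSimplex ℝ A) : p ∈ Q.ball p := by
  have hγ : (fun a b => if a = b then p a else 0) ∈ transportPlans p p := by
    refine ⟨fun a b => ?_, fun a => by simp, fun b => by simp⟩
    dsimp only
    split_ifs
    exacts [hp.1 a, le_rfl]
  refine ⟨hp, (wasserstein_le_cost hQ.dist_nonneg hγ).trans ?_⟩
  simpa [hQ.dist_self] using hQ.r_nonneg

lemma bddAbove_z (Q : DRProblem m A) (p : A → ℝ) (x : Fin m → ℝ) :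
    BddAbove ((fun q : A → ℝ => ∑ a, q a * Q.g x a) '' Q.ball p) := by
  refine ⟨∑ a, |Q.g x a|, ?_⟩
  rintro _ ⟨q, hq, rfl⟩
  refine Finset.sum_le_sum fun a _ => ?_
  have h0 := hq.1.1 a
  have h1 : q a ≤ 1 := by
    rw [← hq.1.2]
    exact Finset.single_le_sum (fun b _ => hq.1.1 b) (Finset.mem_univ a)
  calc q a * Q.g x a ≤ q a * |Q.g x a| := mul_le_mul_of_nonneg_left (le_abs_self _) h0
    _ ≤ 1 * |Q.g x a| := mul_le_mul_of_nonneg_right h1 (abs_nonneg _)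
    _ = _ := one_mul _

/-- Weak duality. -/
lemma IsAdmissible.z_le_dual [DecidableEq A] (hQ : Q.IsAdmissible lam τ) {p : A → ℝ}
    (hp : p ∈ stdSimplex ℝ A) (x : Fin m → ℝ) {y : ℝ} (hy : 0 ≤ y) :
    Q.z p x ≤ Q.r * y + ∑ a, p a * dualLoss Q.dist (Q.g x) y a := by
  refine csSup_le (Set.Nonempty.image _ ⟨p, hQ.mem_ball_self hp⟩) ?_
  rintro _ ⟨q, hq, rfl⟩
  refine le_of_forall_pos_le_add fun η hη => ?_
  have hlt : wasserstein Q.dist p q < Q.r + η / (y + 1) :=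
    hq.2.trans_lt (lt_add_of_pos_right _ (by positivity))
  obtain ⟨_, ⟨γ, hγ, rfl⟩, hcost⟩ := exists_lt_of_csInf_lt
    (Set.Nonempty.image _ ⟨_, transportPlans_prod hp hq.1⟩) hlt
  have h1 : ∑ a, q a * Q.g x a ≤ ∑ a, p a * dualLoss Q.dist (Q.g x) y a
      + y * ∑ a, ∑ b, γ a b * Q.dist a b := by
    calc ∑ b, q b * Q.g x b = ∑ a, ∑ b, γ a b * Q.g x b := by
          rw [Finset.sum_comm]
          exact Finset.sum_congr rfl fun b _ => by rw [← Finset.sum_mul, hγ.2.2 b]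
      _ ≤ ∑ a, ∑ b, (γ a b * dualLoss Q.dist (Q.g x) y a + y * (γ a b * Q.dist a b)) := by
          refine Finset.sum_le_sum fun a _ => Finset.sum_le_sum fun b _ => ?_
          have := mul_le_mul_of_nonneg_left (le_dualLoss Q.dist (Q.g x) y a b) (hγ.1 a b)
          linarith
      _ = _ := by
          simp only [Finset.sum_add_distrib, ← Finset.mul_sum, ← Finset.sum_mul, hγ.2.1]
  have h2 : y * (η / (y + 1)) ≤ η := by
    rw [← mul_div_assoc, div_le_iff₀ (by positivity)]
    nlinarith
  have h3 := mul_le_mul_of_nonneg_left hcost.le hy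
  dsimp only at h3 ⊢
  linarith

/-- Strong duality, up to an arbitrarily small error. The pairs (cost, value) of all plans out of
`p` form a compact convex set in the plane, which is disjoint from the quadrant of pairs of cost at
most `r` and value at least `z + η`; the slope of a separating line is the price `y`. -/
lemma IsAdmissible.exists_dual_le [DecidableEq A] (hQ : Q.IsAdmissible lam τ) {p : A → ℝ}
    (hp : p ∈ stdSimplex ℝ A) (x : Fin m → ℝ) {η : ℝ} (hη : 0 < η) :
    ∃ y, 0 ≤ y ∧ Q.r * y + ∑ a, p a * dualLoss Q.dist (Q.g x) y a ≤ Q.z p x + η := by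
  set f := Q.g x with hf
  let T : (A → A → ℝ) →ₗ[ℝ] ℝ × ℝ :=
    { toFun := fun γ => (∑ a, ∑ b, γ a b * Q.dist a b, ∑ a, ∑ b, γ a b * f b)
      map_add' := fun γ γ' => by simp [add_mul, Finset.sum_add_distrib]
      map_smul' := fun t γ => by simp [mul_assoc, Finset.mul_sum] }
  have hT : Continuous T := T.continuous_of_finiteDimensional
  have hdisj : Disjoint (T '' plansFrom p) (Set.Iic Q.r ×ˢ Set.Ici (Q.z p x + η)) := by
    rw [Set.disjoint_left]
    rintro _ ⟨γ, hγ, rfl⟩ ⟨h1, h2⟩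
    have h1 : ∑ a, ∑ b, γ a b * Q.dist a b ≤ Q.r := h1
    have h2 : Q.z p x + η ≤ ∑ a, ∑ b, γ a b * f b := h2
    have hpl : γ ∈ transportPlans p (fun b => ∑ a, γ a b) := ⟨hγ.1, hγ.2, fun _ => rfl⟩
    have hball : (fun b => ∑ a, γ a b) ∈ Q.ball p := by
      refine ⟨⟨fun b => Finset.sum_nonneg fun a _ => hγ.1 a b, ?_⟩,
        (wasserstein_le_cost hQ.dist_nonneg hpl).trans h1⟩
      rw [Finset.sum_comm]
      simp only [hγ.2, hp.2]
    have h3 : ∑ b, (∑ a, γ a b) * Q.g x b ≤ Q.z p x :=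
      le_csSup (bddAbove_z Q p x) ⟨_, hball, rfl⟩
    simp only [Finset.sum_mul] at h3
    rw [Finset.sum_comm] at h3
    linarith
  obtain ⟨F, u, v, hFu, huv, hvF⟩ := geometric_hahn_banach_compact_closed
    ((convex_plansFrom p).linear_image T) ((isCompact_plansFrom p).image hT)
    ((convex_Iic Q.r).prod (convex_Ici _)) (isClosed_Iic.prod isClosed_Ici) hdisj
  set α := F (1, 0) with hα
  set β := F (0, 1) with hβ
  have hF : ∀ s t, F (s, t) = s * α + t * β := fun s t => by
    have : ((s, t) : ℝ × ℝ) = s • (1, 0) + t • (0, 1) := by simp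
    rw [this, map_add, map_smul, map_smul, smul_eq_mul, smul_eq_mul]
  have hγ0 : (fun a b => if a = b then p a else 0) ∈ plansFrom p := by
    refine ⟨fun a b => ?_, fun a => by simp⟩
    dsimp only
    split_ifs
    exacts [hp.1 a, le_rfl]
  -- The quadrant is unbounded to the left, so the functional cannot increase with the cost.
  have hα0 : α ≤ 0 := by
    by_contra! h
    set M := (|v| + |(Q.z p x + η) * β| + |Q.r| * α) / α with hM
    have hM0 : 0 ≤ M := by positivity
    have := hvF (Q.r - M, Q.z p x + η) ⟨by simpa using hM0, by simp⟩
    rw [hF, sub_mul, hM, div_mul_cancel₀ _ h.ne'] at this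
    have h1 : Q.r * α ≤ |Q.r| * α := mul_le_mul_of_nonneg_right (le_abs_self _) h.le
    linarith [neg_abs_le v, le_abs_self ((Q.z p x + η) * β)]
  -- The plan that moves nothing has cost `0 ≤ r` and value at most `z`.
  have hβ0 : 0 < β := by
    have h1 := hFu _ ⟨_, hγ0, rfl⟩
    have h2 := hvF (Q.r, Q.z p x + η) ⟨by simp, by simp⟩
    have h3 : T (fun a b => if a = b then p a else 0) = (0, ∑ a, p a * f a) := by
      simp [T, hQ.dist_self]
    have h4 : ∑ a, p a * f a ≤ Q.z p x :=
      le_csSup (bddAbove_z Q p x) ⟨p, hQ.mem_ball_self hp, rfl⟩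
    rw [h3, hF] at h1
    rw [hF] at h2
    have h5 : Q.r * α ≤ 0 := mul_nonpos_of_nonneg_of_nonpos hQ.r_nonneg hα0
    by_contra! h
    nlinarith
  refine ⟨-α / β, div_nonneg (neg_nonneg.2 hα0) hβ0.le, ?_⟩
  choose b hb using exists_dualLoss_eq Q.dist f (-α / β)
  have hγ1 : (fun a b' => if b' = b a then p a else 0) ∈ plansFrom p := by
    refine ⟨fun a b => ?_, fun a => by simp⟩
    dsimp only
    split_ifs
    exacts [hp.1 a, le_rfl]
  have h1 := hFu _ ⟨_, hγ1, rfl⟩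
  have h2 := hvF (Q.r, Q.z p x + η) ⟨by simp, by simp⟩
  have h3 : T (fun a b' => if b' = b a then p a else 0)
      = (∑ a, p a * Q.dist a (b a), ∑ a, p a * f (b a)) := by
    simp [T]
  rw [h3, hF] at h1
  rw [hF] at h2
  have h4 : ∑ a, p a * dualLoss Q.dist f (-α / β) a
      = ∑ a, p a * f (b a) + α / β * ∑ a, p a * Q.dist a (b a) := by
    rw [Finset.mul_sum, ← Finset.sum_add_distrib]
    refine Finset.sum_congr rfl fun a _ => ?_
    rw [← hb]
    ring
  rw [h4]
  have h5 := h1.trans (huv.trans h2)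
  have h6 : β * (Q.r * (-α / β) + (∑ a, p a * f (b a) + α / β * ∑ a, p a * Q.dist a (b a)))
      ≤ β * (Q.z p x + η) := by
    have : β * (Q.r * (-α / β) + (∑ a, p a * f (b a) + α / β * ∑ a, p a * Q.dist a (b a)))
      = -(Q.r * α) + β * (∑ a, p a * f (b a)) + α * ∑ a, p a * Q.dist a (b a) := by
      field_simp
      ring
    rw [this]
    linarith
  exact le_of_mul_le_mul_left h6 hβ0

end DRProblem

/-! ### A grid adapted to a continuous function -/

/-- For a continuous function `φ` on `[a, b]` with values in `[0, n * s]` there are `n + 1` points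
such that every `y` has one of them to its right at which `φ` is at least `φ y - s`: take the last
point of every level set `{i * s ≤ φ}`. For an antitone `φ`, these points bracket it up to `s`. -/
lemma exists_grid_of_continuous {φ : ℝ → ℝ} {a b s : ℝ} {n : ℕ} (hab : a ≤ b) (hs : 0 < s)
    (hc : Continuous φ) (h0 : ∀ y, 0 ≤ φ y) (hn : ∀ y ∈ Set.Icc a b, φ y ≤ n * s) :
    ∃ Y : Fin (n + 1) → ℝ, (∀ i, Y i ∈ Set.Icc a b) ∧
      ∀ y ∈ Set.Icc a b, ∃ i, y ≤ Y i ∧ φ y ≤ φ (Y i) + s := by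
  have hJ : ∀ i : Fin (n + 1), ∃ t ∈ Set.Icc a b,
      ∀ y ∈ Set.Icc a b, (i : ℕ) * s ≤ φ y → y ≤ t ∧ (i : ℕ) * s ≤ φ t := by
    intro i
    have hcomp : IsCompact (Set.Icc a b ∩ {y | (i : ℕ) * s ≤ φ y}) :=
      isCompact_Icc.inter_right (isClosed_le continuous_const hc)
    rcases (Set.Icc a b ∩ {y | (i : ℕ) * s ≤ φ y}).eq_empty_or_nonempty with h | h
    · refine ⟨a, ⟨le_rfl, hab⟩, fun y hy hy' => ?_⟩
      exact absurd (show y ∈ (∅ : Set ℝ) from h ▸ ⟨hy, hy'⟩) (Set.notMem_empty y)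
    · obtain ⟨t, ht, ht'⟩ := hcomp.exists_isGreatest h
      exact ⟨t, ht.1, fun y hy hy' => ⟨ht' ⟨hy, hy'⟩, ht.2⟩⟩
  choose Y hY hY' using hJ
  refine ⟨Y, hY, fun y hy => ?_⟩
  have hq : 0 ≤ φ y / s := div_nonneg (h0 y) hs.le
  have hlt : ⌊φ y / s⌋₊ < n + 1 := by
    rw [Nat.lt_succ_iff]
    have : φ y / s ≤ n := (div_le_iff₀ hs).2 (hn y hy)
    exact_mod_cast (Nat.floor_le hq).trans this
  have h1 : (⌊φ y / s⌋₊ : ℝ) * s ≤ φ y := (le_div_iff₀ hs).1 (Nat.floor_le hq)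
  have h2 : φ y < (⌊φ y / s⌋₊ + 1 : ℝ) * s := (div_lt_iff₀ hs).1 (Nat.lt_floor_add_one _)
  obtain ⟨h3, h4⟩ := hY' ⟨_, hlt⟩ y hy h1
  refine ⟨⟨_, hlt⟩, h3, ?_⟩
  dsimp only at h4
  linarith

/-! ### Empirical distributions -/

section Empirical

variable {A : Type*} [Fintype A] [DecidableEq A]

lemma sum_empirical_mul {N : ℕ} (s : Fin N → A) (φ : A → ℝ) :
    ∑ a, empirical s a * φ a = (∑ n, φ (s n)) / N := by
  rw [← Finset.sum_fiberwise_of_maps_to (s := Finset.univ) (t := Finset.univ) (g := s)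
    (fun _ _ => Finset.mem_univ _), Finset.sum_div]
  refine Finset.sum_congr rfl fun a _ => ?_
  rw [Finset.sum_congr rfl (g := fun _ => φ a)
    (fun n hn => by rw [(Finset.mem_filter.1 hn).2]), Finset.sum_const, nsmul_eq_mul, empirical]
  ring

lemma empirical_mem_stdSimplex {N : ℕ} (hN : 0 < N) (s : Fin N → A) :
    empirical s ∈ stdSimplex ℝ A := by
  refine ⟨fun a => by unfold empirical; positivity, ?_⟩
  have := sum_empirical_mul s fun _ => 1
  simp only [mul_one, Finset.sum_const, Finset.card_univ, Fintype.card_fin, nsmul_eq_mul] at this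
  rw [this, div_self (by exact_mod_cast hN.ne')]

end Empirical

/-! ### Concentration of empirical means -/

/-- Disjoint groups of independent random variables are independent as groups. -/
lemma iIndepFun_curry {A ι κ Ω : Type*} [MeasurableSpace A] [MeasurableSpace Ω] {μ : Measure Ω}
    [IsProbabilityMeasure μ] {S : ι → κ → Ω → A}
    (hS : ∀ i n, Measurable (S i n)) (h : iIndepFun (fun t : ι × κ => S t.1 t.2) μ) :
    iIndepFun (fun i ω n => S i n ω) μ := by
  have h' : iIndepFun (fun (t : (_ : ι) × κ) ω => S t.1 t.2 ω) μ :=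
    h.precomp (Equiv.sigmaEquivProd ι κ).injective
  have hi : ∀ i, iIndepFun (S i) μ := fun i => 
    h.precomp (g := fun n => (i, n)) (Prod.mk_right_injective i)
  have : ∀ i n, IsProbabilityMeasure (μ.map (S i n)) :=
    fun i n => Measure.isProbabilityMeasure_map (hS i n).aemeasurable
  have : ∀ i, IsProbabilityMeasure (μ.map (fun ω n => S i n ω)) :=
    fun i => Measure.isProbabilityMeasure_map (Measurable.aemeasurable (by fun_prop))
  have hcurry : (MeasurableEquiv.piCurry fun (_ : ι) (_ : κ) => A) ∘ (fun ω t => S t.1 t.2 ω)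
      = fun ω i n => S i n ω := by
    ext; simp [Sigma.curry]
  rw [iIndepFun_iff_map_fun_eq_infinitePi_map (by fun_prop), ← hcurry,
    ← Measure.map_map (by fun_prop) (by fun_prop),
    (iIndepFun_iff_map_fun_eq_infinitePi_map (by fun_prop)).1 h',
    Measure.infinitePi_map_piCurry (fun i n => μ.map (S i n))]
  congrm Measure.infinitePi fun i => ?_
  rw [(iIndepFun_iff_map_fun_eq_infinitePi_map (by fun_prop)).1 (hi i)]

section Concentration

variable {A : Type*} [Fintype A] [MeasurableSpace A] [DiscreteMeasurableSpace A]
  {Ω : Type*} [MeasurableSpace Ω] {μ : Measure Ω} [IsProbabilityMeasure μ] {p : A → ℝ}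

lemma integral_comp_of_law {S : Ω → A} (hS : Measurable S)
    (hlaw : ∀ a, μ.real (S ⁻¹' {a}) = p a) (φ : A → ℝ) :
    ∫ ω, φ (S ω) ∂μ = ∑ a, p a * φ a := by
  have := Measure.isProbabilityMeasure_map (μ := μ) hS.aemeasurable
  rw [← integral_map (φ := S) hS.aemeasurable
    (Measurable.of_discrete (f := φ)).aestronglyMeasurable, integral_fintype .of_finite]
  refine Finset.sum_congr rfl fun a _ => ?_
  rw [map_measureReal_apply hS (measurableSet_singleton a), hlaw, smul_eq_mul]

variable [DecidableEq A]

/-- Hoeffding's inequality for the lower tail of an empirical mean. -/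
lemma measure_empirical_mean_le {N : ℕ} (hN : 0 < N) {S : Fin N → Ω → A}
    (hS : ∀ n, Measurable (S n)) (hlaw : ∀ n a, μ.real (S n ⁻¹' {a}) = p a)
    (hind : iIndepFun S μ) {φ : A → ℝ} {M s : ℝ} (hM : 0 < M) (hs : 0 ≤ s)
    (h0 : ∀ a, 0 ≤ φ a) (h1 : ∀ a, φ a ≤ M) :
    μ.real {ω | ∑ a, empirical (fun n => S n ω) a * φ a ≤ ∑ a, p a * φ a - s}
      ≤ Real.exp (-(2 * N * (s / M) ^ 2)) := by
  have hN' : (0 : ℝ) < N := by exact_mod_cast hN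
  set E := ∑ a, p a * φ a with hE
  have hint : ∀ n, ∫ ω, -φ (S n ω) ∂μ = -E := fun n => by
    rw [integral_neg, integral_comp_of_law (hS n) (hlaw n)]
  have hsub : ∀ n, HasSubgaussianMGF (fun ω => -φ (S n ω) - -E) ((‖(0 : ℝ) - -M‖₊ / 2) ^ 2) μ :=
    fun n => by
      rw [← hint n]
      exact hasSubgaussianMGF_of_mem_Icc
        (Measurable.of_discrete.comp (hS n)).neg.aemeasurable
        (Filter.Eventually.of_forall fun ω => ⟨neg_le_neg (h1 _), neg_nonpos.2 (h0 _)⟩)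
  have hind' : iIndepFun (fun n ω => -φ (S n ω) - -E) μ :=
    hind.comp (fun _ a => -φ a - -E) fun n => Measurable.of_discrete
  have key := HasSubgaussianMGF.measure_sum_ge_le_of_iIndepFun hind' (s := Finset.univ)
    (fun n _ => hsub n) (ε := N * s) (by positivity)
  refine (measureReal_mono ?_).trans (key.trans_eq ?_)
  · intro ω hω
    have hω : ∑ a, empirical (fun n => S n ω) a * φ a ≤ E - s := hω
    rw [sum_empirical_mul, div_le_iff₀ hN'] at hω
    simp only [Set.mem_ofPred_eq, Finset.sum_sub_distrib, Finset.sum_neg_distrib,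
      Finset.sum_const, Finset.card_univ, Fintype.card_fin, nsmul_eq_mul]
    linarith
  · congr 1
    simp only [zero_sub, neg_neg, Finset.sum_const, Finset.card_univ, Fintype.card_fin,
      nsmul_eq_mul, NNReal.coe_mul, NNReal.coe_natCast, NNReal.coe_pow, NNReal.coe_div,
      coe_nnnorm, Real.norm_of_nonneg hM.le, NNReal.coe_ofNat]
    field_simp

/-- Markov's inequality in each of `k` independent groups: it is unlikely that all the empirical
means exceed `1 + ε` times an upper bound of the true mean. -/
lemma measure_forall_lt_empirical_mean_le {k N : ℕ} (hN : 0 < N) {S : Fin k → Fin N → Ω → A}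
    (hS : ∀ i n, Measurable (S i n)) (hlaw : ∀ i n a, μ.real (S i n ⁻¹' {a}) = p a)
    (hind : iIndepFun (fun t : Fin k × Fin N => S t.1 t.2) μ) {φ : A → ℝ} (h0 : ∀ a, 0 ≤ φ a)
    {B ε : ℝ} (hB : 0 < B) (hε : 0 ≤ ε) (hφ : ∑ a, p a * φ a ≤ B) :
    μ.real {ω | ∀ i, (1 + ε) * B ≤ ∑ a, empirical (fun n => S i n ω) a * φ a}
      ≤ (1 / (1 + ε)) ^ k := by
  have hN' : (0 : ℝ) < N := by exact_mod_cast hN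
  set U : Set (Fin N → A) := {s | (1 + ε) * B ≤ ∑ a, empirical s a * φ a} with hU
  have hset : {ω | ∀ i, (1 + ε) * B ≤ ∑ a, empirical (fun n => S i n ω) a * φ a}
      = ⋂ i, (fun ω n => S i n ω) ⁻¹' U := by
    ext ω; simp [hU]
  have hUm : MeasurableSet U := U.toFinite.measurableSet
  have hmul : μ (⋂ i, (fun ω n => S i n ω) ⁻¹' U) = ∏ i, μ ((fun ω n => S i n ω) ⁻¹' U) :=
    (iIndepFun_curry hS hind).meas_iInter fun i => ⟨U, hUm, rfl⟩
  rw [hset, measureReal_def, hmul, ENNReal.toReal_prod]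
  calc ∏ i, (μ ((fun ω n => S i n ω) ⁻¹' U)).toReal ≤ ∏ _i : Fin k, 1 / (1 + ε) := by
        refine Finset.prod_le_prod (fun _ _ => ENNReal.toReal_nonneg) fun i _ => ?_
        have hint : ∀ n, Integrable (fun ω => φ (S i n ω)) μ := fun n =>
          Integrable.of_finite (μ := μ.map (S i n)) (f := φ) |>.comp_measurable (hS i n)
        have hI : ∫ ω, ∑ a, empirical (fun n => S i n ω) a * φ a ∂μ = ∑ a, p a * φ a := by
          simp only [sum_empirical_mul]
          rw [integral_div, integral_finsetSum _ fun n _ => hint n]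
          simp only [integral_comp_of_law (hS i _) (hlaw i _), Finset.sum_const,
            Finset.card_univ, Fintype.card_fin, nsmul_eq_mul]
          field_simp
        have hmk := mul_meas_ge_le_integral_of_nonneg (μ := μ)
          (f := fun ω => ∑ a, empirical (fun n => S i n ω) a * φ a)
          (Filter.Eventually.of_forall fun ω => Finset.sum_nonneg fun a _ =>
            mul_nonneg ((empirical_mem_stdSimplex hN _).1 a) (h0 a))
          (by simp only [sum_empirical_mul]
              exact (integrable_finsetSum _ fun n _ => hint n).div_const _) ((1 + ε) * B)
        rw [hI] at hmk
        rw [le_div_iff₀ (by positivity)]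
        have h2 : B * (μ.real ((fun ω n => S i n ω) ⁻¹' U) * (1 + ε)) ≤ B * 1 := by
          have : (1 + ε) * B * μ.real ((fun ω n => S i n ω) ⁻¹' U) ≤ B := hmk.trans hφ
          linarith
        exact le_of_mul_le_mul_left h2 hB
    _ = _ := by simp

end Concentration

/-! ### Cheap and expensive scenarios -/

namespace DRProblem

variable {m : ℕ} {A : Type*} {Q : DRProblem m A} {lam τ : ℝ}

lemma IsAdmissible.cost_nonneg (hQ : Q.IsAdmissible lam τ) {x : Fin m → ℝ} (hx : x ∈ Q.X) :
    0 ≤ Q.c ⬝ᵥ x :=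
  dotProduct_nonneg_of_nonneg hQ.c_nonneg (hQ.X_nonneg x hx)

variable [Fintype A]

lemma IsAdmissible.dualLoss_nonneg (hQ : Q.IsAdmissible lam τ) {x : Fin m → ℝ} (hx : x ∈ Q.X)
    (y : ℝ) (a : A) : 0 ≤ dualLoss Q.dist (Q.g x) y a :=
  (hQ.g_nonneg x hx a).trans (self_le_dualLoss hQ.dist_self y a)

/-- The loss of a scenario at price `y`, set to zero on the scenarios that the inaction `x = 0`
makes more expensive than `M` at the reference price `y₀`. -/
noncomputable def lowLoss (Q : DRProblem m A) (y₀ M : ℝ)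
    (x : Fin m → ℝ) (y : ℝ) (a : A) : ℝ :=
  if dualLoss Q.dist (Q.g 0) y₀ a ≤ M then dualLoss Q.dist (Q.g x) y a else 0

lemma IsAdmissible.lowLoss_nonneg (hQ : Q.IsAdmissible lam τ) {x : Fin m → ℝ} (hx : x ∈ Q.X)
    (y₀ M y : ℝ) (a : A) : 0 ≤ Q.lowLoss y₀ M x y a := by
  unfold lowLoss
  split_ifs
  exacts [hQ.dualLoss_nonneg hx y a, le_rfl]

lemma IsAdmissible.lowLoss_le (hQ : Q.IsAdmissible lam τ) {x : Fin m → ℝ} (hx : x ∈ Q.X)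
    {y₀ M y : ℝ} (hM : 0 ≤ M) (hy : y₀ ≤ y) (a : A) :
    Q.lowLoss y₀ M x y a ≤ M := by
  unfold lowLoss
  split_ifs with h
  · exact ((dualLoss_antitone hQ.dist_nonneg a hy).trans
      (dualLoss_mono (hQ.g_le x hx) y₀ a)).trans h
  · exact hM

lemma IsAdmissible.lowLoss_antitone (hQ : Q.IsAdmissible lam τ) (y₀ M : ℝ) (x : Fin m → ℝ)
    (a : A) : Antitone fun y => Q.lowLoss y₀ M x y a := by
  intro y y' h
  simp only [lowLoss]
  split_ifs
  exacts [dualLoss_antitone hQ.dist_nonneg a h, le_rfl]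

lemma continuous_lowLoss (Q : DRProblem m A) (y₀ M : ℝ) (x : Fin m → ℝ) (a : A) :
    Continuous fun y => Q.lowLoss y₀ M x y a := by
  simp only [lowLoss]
  split_ifs
  exacts [continuous_dualLoss _ _ a, continuous_const]

/-- The scenarios above the threshold `lam * B / ε` are so unlikely that the inflation bound costs
at most the first-stage cost of `x`: even with no first-stage action, they and the transport budget
together cost at most `B`. -/
lemma IsAdmissible.budget_add_high_le (hQ : Q.IsAdmissible lam τ) {p : A → ℝ}
    (hp : p ∈ stdSimplex ℝ A) {x : Fin m → ℝ} (hx : x ∈ Q.X) {y B ε : ℝ} (hy : 0 ≤ y)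
    (hB : 0 < B) (hε : 0 < ε) (hε' : ε ≤ 1 / 3)
    (hxy : Q.c ⬝ᵥ x + (Q.r * y + ∑ a, p a * dualLoss Q.dist (Q.g x) y a) ≤ B) :
    Q.r * y + ∑ a, p a * (if dualLoss Q.dist (Q.g 0) y a ≤ lam * B / ε then 0
      else dualLoss Q.dist (Q.g 0) y a) ≤ B := by
  set M := lam * B / ε with hM
  set W := ∑ a, p a * dualLoss Q.dist (Q.g x) y a with hW
  set H := ∑ a, p a * (if dualLoss Q.dist (Q.g 0) y a ≤ M then 0
      else dualLoss Q.dist (Q.g 0) y a) with hH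
  set t := ∑ a, p a * (if dualLoss Q.dist (Q.g 0) y a ≤ M then 0 else 1) with ht
  set K := Q.c ⬝ᵥ x with hK
  have hK0 : 0 ≤ K := hQ.cost_nonneg hx
  have hR0 : 0 ≤ Q.r * y := mul_nonneg hQ.r_nonneg hy
  have hl : 0 < lam := one_pos.trans_le hQ.one_le_lam
  have ht0 : 0 ≤ t := Finset.sum_nonneg fun a _ => mul_nonneg (hp.1 a) (by split_ifs <;> simp)
  have h1 : M * t ≤ H := by
    rw [ht, Finset.mul_sum]
    refine Finset.sum_le_sum fun a _ => ?_
    rw [mul_left_comm]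
    refine mul_le_mul_of_nonneg_left ?_ (hp.1 a)
    split_ifs with h
    · simp
    · simpa using (not_le.1 h).le
  have h2 : H ≤ W + lam * K * t := by
    rw [ht, Finset.mul_sum, hW, ← Finset.sum_add_distrib]
    refine Finset.sum_le_sum fun a _ => ?_
    rw [mul_left_comm, ← mul_add]
    refine mul_le_mul_of_nonneg_left ?_ (hp.1 a)
    split_ifs with h
    · simpa using hQ.dualLoss_nonneg hx y a
    · simpa using dualLoss_le_add (d := Q.dist) (hQ.inflation x hx) y a
  have h3 : lam * B * t ≤ ε * (W + lam * K * t) := by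
    have : lam * B * t = ε * (M * t) := by rw [hM]; field_simp
    rw [this]
    exact mul_le_mul_of_nonneg_left (h1.trans h2) hε.le
  have h4 : lam * K * t ≤ lam * B * t := by
    have hW0 : 0 ≤ W :=
      Finset.sum_nonneg fun a _ => mul_nonneg (hp.1 a) (hQ.dualLoss_nonneg hx y a)
    exact mul_le_mul_of_nonneg_right (mul_le_mul_of_nonneg_left (by linarith) hl.le) ht0
  have h5 : lam * t ≤ 1 := by
    have : B * (lam * t) ≤ B * 1 := by
      have h6 : ε * (W + lam * K * t) ≤ 1 / 3 * (B + lam * B * t) := by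
        refine mul_le_mul hε' (by linarith) ?_ (by norm_num)
        have : 0 ≤ H := (mul_nonneg (by positivity) ht0).trans h1
        linarith
      linarith
    exact le_of_mul_le_mul_left this hB
  have h6 : lam * K * t ≤ K := by
    have := mul_le_mul_of_nonneg_left h5 hK0
    linarith
  linarith

/-- If the empirical means under `p'` of the losses of the cheap scenarios are not much smaller than
the true means, then the true objective exceeds the empirical one by little more than the budget
`B`: raise a dual optimal price for `p'` to at least `y₀`, which pays `Q.r * y₀` and makes the
expensive scenarios cost no more than at `y₀`. -/
lemma IsAdmissible.h_le_of_lowLoss_le [DecidableEq A] (hQ : Q.IsAdmissible lam τ) {p p' : A → ℝ}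
    (hp : p ∈ stdSimplex ℝ A) (hp' : p' ∈ stdSimplex ℝ A) {x : Fin m → ℝ} (hx : x ∈ Q.X)
    {y₀ M B e η : ℝ} (hy₀ : 0 ≤ y₀) (hη : 0 < η)
    (hhigh : Q.r * y₀ + ∑ a, p a * (if dualLoss Q.dist (Q.g 0) y₀ a ≤ M then 0
      else dualLoss Q.dist (Q.g 0) y₀ a) ≤ B)
    (hlow : ∀ y ∈ Set.Icc y₀ (max τ y₀),
      ∑ a, p a * Q.lowLoss y₀ M x y a ≤ ∑ a, p' a * Q.lowLoss y₀ M x y a + e) :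
    Q.h p x ≤ Q.h p' x + e + B + η := by
  obtain ⟨ŷ, hŷ, hdual⟩ := hQ.exists_dual_le hp' x hη
  set y := max (min ŷ τ) y₀ with hy
  have hy0 : y₀ ≤ y := le_max_right _ _
  have hyT : y ≤ max τ y₀ := max_le_max_right _ (min_le_right _ _)
  have h1 := hQ.z_le_dual hp x (hy₀.trans hy0)
  have h2 : Q.r * y ≤ Q.r * ŷ + Q.r * y₀ := by
    rw [← mul_add]
    exact mul_le_mul_of_nonneg_left (max_le ((min_le_left _ _).trans (by linarith)) (by linarith))
      hQ.r_nonneg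
  have h3 : ∑ a, p a * dualLoss Q.dist (Q.g x) y a ≤ ∑ a, p a * Q.lowLoss y₀ M x y a
      + ∑ a, p a * (if dualLoss Q.dist (Q.g 0) y₀ a ≤ M then 0
        else dualLoss Q.dist (Q.g 0) y₀ a) := by
    rw [← Finset.sum_add_distrib]
    refine Finset.sum_le_sum fun a _ => ?_
    rw [← mul_add]
    refine mul_le_mul_of_nonneg_left ?_ (hp.1 a)
    unfold lowLoss
    split_ifs
    · simp
    · rw [zero_add]
      exact (dualLoss_antitone hQ.dist_nonneg a hy0).trans (dualLoss_mono (hQ.g_le x hx) y₀ a)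
  have h4 := hlow y ⟨hy0, hyT⟩
  have h5 : ∑ a, p' a * Q.lowLoss y₀ M x y a ≤ ∑ a, p' a * dualLoss Q.dist (Q.g x) ŷ a := by
    refine Finset.sum_le_sum fun a _ => mul_le_mul_of_nonneg_left ?_ (hp'.1 a)
    unfold lowLoss
    split_ifs
    · rw [← dualLoss_min hQ.dist_nonneg hQ.dist_self (hQ.lipschitz x hx) ŷ a]
      exact dualLoss_antitone hQ.dist_nonneg a (le_max_left _ _)
    · exact hQ.dualLoss_nonneg hx ŷ a
  unfold h
  linarith

lemma IsAdmissible.h_nonneg [DecidableEq A] (hQ : Q.IsAdmissible lam τ) {p : A → ℝ}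
    (hp : p ∈ stdSimplex ℝ A) {x : Fin m → ℝ} (hx : x ∈ Q.X) : 0 ≤ Q.h p x := by
  have h1 : ∑ a, p a * Q.g x a ≤ Q.z p x :=
    le_csSup (bddAbove_z Q p x) ⟨p, hQ.mem_ball_self hp, rfl⟩
  have h2 : 0 ≤ ∑ a, p a * Q.g x a :=
    Finset.sum_nonneg fun a _ => mul_nonneg (hp.1 a) (hQ.g_nonneg x hx a)
  exact add_nonneg (hQ.cost_nonneg hx) (h2.trans h1)

lemma IsAdmissible.exists_h_eq_opt (hQ : Q.IsAdmissible lam τ) (p : A → ℝ) :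
    ∃ x ∈ Q.X, Q.h p x = Q.opt p := by
  obtain ⟨x, hx, h⟩ := Set.Nonempty.csInf_mem (s := Q.h p '' (Q.X : Set (Fin m → ℝ)))
    (Set.Nonempty.image _ ⟨0, hQ.zero_mem⟩) (Q.X.finite_toSet.image _)
  exact ⟨x, hx, h⟩

lemma opt_le (Q : DRProblem m A) (p : A → ℝ) {x : Fin m → ℝ} (hx : x ∈ Q.X) :
    Q.opt p ≤ Q.h p x :=
  csInf_le (Q.X.finite_toSet.image _).bddBelow ⟨x, hx, rfl⟩

/-! ### Uniform convergence over actions and prices -/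

/-- Uniform lower-tail bound for the losses of the cheap scenarios, over all groups of samples, all
actions and all prices in an interval. Hoeffding's inequality is applied only at the prices of a
grid; monotonicity in the price extends it to the others. -/
lemma IsAdmissible.measure_exists_lowLoss_lt [DecidableEq A] [MeasurableSpace A]
    [DiscreteMeasurableSpace A] (hQ : Q.IsAdmissible lam τ) {p : A → ℝ}
    (hp : p ∈ stdSimplex ℝ A) {Ω : Type*} [MeasurableSpace Ω] {μ : Measure Ω}
    [IsProbabilityMeasure μ] {k N : ℕ} (hN : 0 < N) {S : Fin k → Fin N → Ω → A}
    (hS : ∀ i n, Measurable (S i n)) (hlaw : ∀ i n a, μ.real (S i n ⁻¹' {a}) = p a)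
    (hind : iIndepFun (fun t : Fin k × Fin N => S t.1 t.2) μ) {y₀ y₁ M s : ℝ} (hy : y₀ ≤ y₁)
    (hM : 0 < M) (hs : 0 < s) {n : ℕ} (hn : M ≤ n * s) :
    μ.real {ω | ∃ i, ∃ x ∈ Q.X, ∃ y ∈ Set.Icc y₀ y₁,
        ∑ a, empirical (fun n => S i n ω) a * Q.lowLoss y₀ M x y a + 2 * s
          < ∑ a, p a * Q.lowLoss y₀ M x y a}
      ≤ k * (Q.X.card * (n + 1)) * Real.exp (-(2 * N * (s / M) ^ 2)) := by
  have hgrid : ∀ x : Q.X, ∃ Y : Fin (n + 1) → ℝ, (∀ i, Y i ∈ Set.Icc y₀ y₁) ∧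
      ∀ y ∈ Set.Icc y₀ y₁, ∃ i, y ≤ Y i ∧ ∑ a, p a * Q.lowLoss y₀ M x y a
        ≤ ∑ a, p a * Q.lowLoss y₀ M x (Y i) a + s := fun x =>
    exists_grid_of_continuous (φ := fun y => ∑ a, p a * Q.lowLoss y₀ M x y a) hy hs
      (continuous_finsetSum _ fun a _ => (continuous_lowLoss Q y₀ M x a).const_mul _)
      (fun y => Finset.sum_nonneg fun a _ =>
        mul_nonneg (hp.1 a) (hQ.lowLoss_nonneg x.2 y₀ M y a))
      (fun y hy => by
        refine le_trans ?_ hn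
        calc ∑ a, p a * Q.lowLoss y₀ M x y a ≤ ∑ a, p a * M := Finset.sum_le_sum fun a _ =>
              mul_le_mul_of_nonneg_left (hQ.lowLoss_le x.2 hM.le hy.1 a) (hp.1 a)
          _ = M := by rw [← Finset.sum_mul, hp.2, one_mul])
  choose Y hY hY' using hgrid
  have hsub : {ω | ∃ i, ∃ x ∈ Q.X, ∃ y ∈ Set.Icc y₀ y₁,
        ∑ a, empirical (fun n => S i n ω) a * Q.lowLoss y₀ M x y a + 2 * s
          < ∑ a, p a * Q.lowLoss y₀ M x y a}
      ⊆ ⋃ t : Fin k × Q.X × Fin (n + 1),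
        {ω | ∑ a, empirical (fun n => S t.1 n ω) a * Q.lowLoss y₀ M t.2.1 (Y t.2.1 t.2.2) a
          ≤ ∑ a, p a * Q.lowLoss y₀ M t.2.1 (Y t.2.1 t.2.2) a - s} := by
    rintro ω ⟨i, x, hx, y, hy, hlt⟩
    obtain ⟨l, hl, hl'⟩ := hY' ⟨x, hx⟩ y hy
    refine Set.mem_iUnion.2 ⟨(i, ⟨x, hx⟩, l), ?_⟩
    have : ∑ a, empirical (fun n => S i n ω) a * Q.lowLoss y₀ M x (Y ⟨x, hx⟩ l) a
        ≤ ∑ a, empirical (fun n => S i n ω) a * Q.lowLoss y₀ M x y a :=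
      Finset.sum_le_sum fun a _ => mul_le_mul_of_nonneg_left
        (hQ.lowLoss_antitone y₀ M x a hl) ((empirical_mem_stdSimplex hN _).1 a)
    simp only [Set.mem_ofPred_eq]
    dsimp only at hl'
    linarith
  refine (measureReal_mono hsub).trans ((measureReal_iUnion_fintype_le _).trans ?_)
  refine (Finset.sum_le_sum (g := fun _ => Real.exp (-(2 * N * (s / M) ^ 2)))
    fun t _ => ?_).trans_eq ?_
  · exact measure_empirical_mean_le hN (hS t.1) (hlaw t.1)
      (hind.precomp (g := fun n => (t.1, n)) (Prod.mk_right_injective t.1)) hM hs.le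
      (fun a => hQ.lowLoss_nonneg t.2.1.2 y₀ M _ a)
      (fun a => hQ.lowLoss_le t.2.1.2 hM.le (hY t.2.1 t.2.2).1 a)
  · simp

end DRProblem

/-! ### Numerical estimates -/

section Numerics

/-- `k ≥ (2 / ε) log (1 / δ)` trials, each of which fails with probability at most `1 / (1 + ε)`,
all fail with probability at most `δ`. -/
lemma one_div_one_add_pow_le {ε δ : ℝ} {k : ℕ} (hε : 0 < ε) (hε' : ε ≤ 1) (hδ : 0 < δ)
    (hk : 2 / ε * Real.log (1 / δ) ≤ k) : (1 / (1 + ε)) ^ k ≤ δ := by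
  have h1 : 1 / (1 + ε) ≤ Real.exp (-(ε / 2)) := by
    have h2 : 1 / (1 + ε) ≤ -(ε / 2) + 1 := by
      rw [div_le_iff₀ (by linarith)]
      nlinarith
    exact h2.trans (Real.add_one_le_exp _)
  calc (1 / (1 + ε)) ^ k ≤ Real.exp (-(ε / 2)) ^ k := by gcongr
    _ = Real.exp (k * -(ε / 2)) := (Real.exp_nat_mul _ _).symm
    _ ≤ Real.exp (Real.log δ) := by
      rw [Real.exp_le_exp]
      rw [one_div, Real.log_inv] at hk
      have := mul_le_mul_of_nonneg_left hk (by positivity : 0 ≤ ε / 2)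
      have h3 : ε / 2 * (2 / ε * -Real.log δ) = -Real.log δ := by field_simp
      linarith
    _ = δ := Real.exp_log hδ

/-- The sample size that makes the union bound over `k` groups, `c` actions and the grid of prices
at most `δ`, when each event is bounded by Hoeffding's inequality at relative accuracy
`ε ^ 2 / lam`. -/
lemma union_bound_le {ε δ lam : ℝ} {k N c : ℕ} (hε : 0 < ε) (hδ : 0 < δ) (hδ' : δ < 1)
    (hl : 1 ≤ lam) (hc : 0 < c) (hk : k = ⌈2 / ε * Real.log (1 / δ)⌉₊)
    (hN : (lam / ε) ^ 4 * (2 * (lam / ε) * Real.log (1 / δ) + Real.log c + (lam / ε) ^ 2 + 1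
      + Real.log (1 / δ)) ≤ N) :
    k * (c * (⌈lam / ε ^ 2⌉₊ + 1)) * Real.exp (-(2 * N * (ε ^ 2 / lam) ^ 2)) ≤ δ := by
  have hl0 : 0 < lam := one_pos.trans_le hl
  set u := lam / ε with hu
  set w := Real.log (1 / δ) with hw
  have hw0 : 0 ≤ w := Real.log_nonneg (by rw [le_div_iff₀ hδ]; linarith)
  have hu0 : 0 < u := by positivity
  have hlc : 0 ≤ Real.log c := Real.log_natCast_nonneg c
  have h1 : (k : ℝ) ≤ Real.exp (2 * u * w) := by
    have h2 : (k : ℝ) ≤ 2 / ε * w + 1 := by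
      rw [hk]; exact (Nat.ceil_lt_add_one (by positivity)).le
    have h3 : 2 / ε * w ≤ 2 * u * w := by
      refine mul_le_mul_of_nonneg_right ?_ hw0
      rw [hu, ← mul_div_assoc]
      gcongr
      linarith
    exact (h2.trans (by linarith)).trans (Real.add_one_le_exp _)
  have h2 : (c : ℝ) = Real.exp (Real.log c) := (Real.exp_log (by exact_mod_cast hc)).symm
  have h3 : (⌈lam / ε ^ 2⌉₊ : ℝ) + 1 ≤ Real.exp (u ^ 2 + 1) := by
    have h4 : (⌈lam / ε ^ 2⌉₊ : ℝ) ≤ lam / ε ^ 2 + 1 :=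
      (Nat.ceil_lt_add_one (by positivity)).le
    have h5 : lam / ε ^ 2 ≤ u ^ 2 := by
      rw [hu, div_pow]
      gcongr
      nlinarith
    exact (by linarith : _ ≤ (u ^ 2 + 1) + 1).trans (Real.add_one_le_exp _)
  set L := 2 * u * w + Real.log c + u ^ 2 + 1 + w with hL
  have hL0 : 0 ≤ L := by positivity
  have h4 : L ≤ 2 * N * (ε ^ 2 / lam) ^ 2 := by
    have h5 : 1 ≤ u ^ 4 * (ε ^ 2 / lam) ^ 2 := by
      have : u ^ 4 * (ε ^ 2 / lam) ^ 2 = lam ^ 2 := by rw [hu]; field_simp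
      rw [this]
      nlinarith
    calc L = L * 1 := (mul_one _).symm
      _ ≤ L * (u ^ 4 * (ε ^ 2 / lam) ^ 2) := mul_le_mul_of_nonneg_left h5 hL0
      _ = u ^ 4 * L * (ε ^ 2 / lam) ^ 2 := by ring
      _ ≤ N * (ε ^ 2 / lam) ^ 2 := mul_le_mul_of_nonneg_right hN (by positivity)
      _ ≤ 2 * N * (ε ^ 2 / lam) ^ 2 := by
        rw [mul_assoc]
        have : 0 ≤ N * (ε ^ 2 / lam) ^ 2 := by positivity
        linarith
  calc k * (c * (⌈lam / ε ^ 2⌉₊ + 1)) * Real.exp (-(2 * N * (ε ^ 2 / lam) ^ 2))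
      ≤ Real.exp (2 * u * w) * (Real.exp (Real.log c) * Real.exp (u ^ 2 + 1))
        * Real.exp (-L) := by
        rw [← h2]
        gcongr
    _ = Real.exp (-w) := by
        rw [← Real.exp_add, ← Real.exp_add, ← Real.exp_add]
        congr 1
        rw [hL]
        ring
    _ = δ := by rw [hw, one_div, Real.log_inv, neg_neg, Real.exp_log hδ]

end Numerics

/-! ### The approximation guarantee -/

theorem mainTheorem1 :
    ∃ (C : ℝ) (P : MvPolynomial (Fin 4) ℝ), 0 ≤ C ∧
      ∀ (m : ℕ) (A : Type*) [Fintype A] [DecidableEq A] [MeasurableSpace A]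
        [DiscreteMeasurableSpace A]
        (Q : DRProblem m A) (lam τ : ℝ) (_ : Q.IsAdmissible lam τ)
        (p : A → ℝ) (_ : p ∈ stdSimplex ℝ A)
        (ε δ κ β ρ : ℝ) (_ : 0 < ε) (_ : ε ≤ 1 / 3) (_ : 0 < δ) (_ : δ < 1) (_ : 0 < κ)
        (_ : 1 ≤ β) (_ : 1 ≤ ρ)
        (k N : ℕ) (_ : k = ⌈2 / ε * Real.log (1 / δ)⌉₊)
        (_ : MvPolynomial.eval ![lam / ε, Real.log (Q.X.card : ℝ), Real.log (τ / κ),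
          Real.log (1 / δ)] P ≤ (N : ℝ))
        (Ω : Type*) [MeasurableSpace Ω] (μ : Measure Ω) [IsProbabilityMeasure μ]
        (S : Fin k → Fin N → Ω → A) (_ : ∀ i n, Measurable (S i n))
        (_ : ∀ i n a, μ.real (S i n ⁻¹' {a}) = p a)
        (_ : iIndepFun (fun t : Fin k × Fin N => S t.1 t.2) μ),
        1 - 3 * δ ≤ μ.real {ω |
          ∀ (xhat : Fin k → Fin m → ℝ) (f : Fin k → ℝ) (j : Fin k),
            (∀ i, xhat i ∈ Q.X) →
            (∀ i, Q.h (empirical fun n => S i n ω) (xhat i) ≤ β * f i) →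
            (∀ i, f i ≤ ρ * Q.opt (empirical fun n => S i n ω)) →
            (∀ i, f j ≤ f i) →
            Q.h p (xhat j) ≤ 4 * β * ρ * (1 + C * ε) * Q.opt p + 2 * β * ρ * κ} := by
  refine ⟨0, MvPolynomial.X 0 ^ 4 * (2 * MvPolynomial.X 0 * MvPolynomial.X 3 + MvPolynomial.X 1
    + MvPolynomial.X 0 ^ 2 + 1 + MvPolynomial.X 3), le_rfl, ?_⟩
  intro m A _ _ _ _ Q lam τ hQ p hp ε δ κ β ρ hε hε' hδ hδ' hκ hβ hρ k N hk hN Ω _ μ _ S hS hlaw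
    hind
  have hN : (lam / ε) ^ 4 * (2 * (lam / ε) * Real.log (1 / δ) + Real.log Q.X.card
      + (lam / ε) ^ 2 + 1 + Real.log (1 / δ)) ≤ N := by
    simpa using hN
  have hl : 0 < lam := one_pos.trans_le hQ.one_le_lam
  have hw : 0 ≤ Real.log (1 / δ) := Real.log_nonneg (by rw [le_div_iff₀ hδ]; linarith)
  have hN0 : 0 < N := by
    have : 0 ≤ Real.log Q.X.card := Real.log_natCast_nonneg _
    exact Nat.cast_pos.1 (lt_of_lt_of_le (by positivity) hN)
  have hXc : 0 < Q.X.card := Finset.card_pos.2 ⟨0, hQ.zero_mem⟩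
  obtain ⟨x₀, hx₀, hopt⟩ := hQ.exists_h_eq_opt p
  have hopt0 : 0 ≤ Q.opt p := hopt ▸ hQ.h_nonneg hp hx₀
  -- The final bound is `β * ρ * ((2 + 3 * ε) * (opt + η) + η)`, so the additive error is at most
  -- `4 * β * ρ * η`.
  set η := κ / 2 with hη
  have hη0 : 0 < η := by positivity
  obtain ⟨y₀, hy₀, hdual⟩ := hQ.exists_dual_le hp x₀ hη0
  set B := Q.opt p + η with hB
  have hB0 : 0 < B := by positivity
  have hxy : Q.c ⬝ᵥ x₀ + (Q.r * y₀ + ∑ a, p a * dualLoss Q.dist (Q.g x₀) y₀ a) ≤ B := by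
    have : Q.c ⬝ᵥ x₀ + Q.z p x₀ = Q.opt p := hopt
    linarith
  set M := lam * B / ε with hM
  have hM0 : 0 < M := by positivity
  have hs0 : 0 < ε * B := by positivity
  have hn : M ≤ ⌈lam / ε ^ 2⌉₊ * (ε * B) := by
    have : M = lam / ε ^ 2 * (ε * B) := by rw [hM]; field_simp
    rw [this]
    exact mul_le_mul_of_nonneg_right (Nat.le_ceil _) hs0.le
  -- The constant `c ⬝ᵥ x₀ + r * y₀` is included in the variable, so that Markov's inequality
  -- bounds the whole dual objective.
  set K := Q.c ⬝ᵥ x₀ + Q.r * y₀ with hK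
  have hK0 : 0 ≤ K := add_nonneg (hQ.cost_nonneg hx₀) (mul_nonneg hQ.r_nonneg hy₀)
  have hmean : ∀ q ∈ stdSimplex ℝ A, ∑ a, q a * (K + dualLoss Q.dist (Q.g x₀) y₀ a)
      = Q.c ⬝ᵥ x₀ + (Q.r * y₀ + ∑ a, q a * dualLoss Q.dist (Q.g x₀) y₀ a) := fun q hq => by
    simp only [mul_add, Finset.sum_add_distrib, ← Finset.sum_mul, hq.2, hK]
    ring
  set bad₁ := {ω | ∀ i, (1 + ε) * B ≤ ∑ a, empirical (fun n => S i n ω) a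
    * (K + dualLoss Q.dist (Q.g x₀) y₀ a)} with hbad₁
  set bad₂ := {ω | ∃ i, ∃ x ∈ Q.X, ∃ y ∈ Set.Icc y₀ (max τ y₀),
    ∑ a, empirical (fun n => S i n ω) a * Q.lowLoss y₀ M x y a + 2 * (ε * B)
      < ∑ a, p a * Q.lowLoss y₀ M x y a} with hbad₂
  have h1 : μ.real bad₁ ≤ δ :=
    (measure_forall_lt_empirical_mean_le hN0 hS hlaw hind
      (fun a => add_nonneg hK0 (hQ.dualLoss_nonneg hx₀ y₀ a)) hB0 hε.le
      ((hmean p hp).trans_le hxy)).trans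
      (one_div_one_add_pow_le hε (by linarith) hδ (by rw [hk]; exact Nat.le_ceil _))
  have h2 : μ.real bad₂ ≤ δ := by
    refine (hQ.measure_exists_lowLoss_lt hp hN0 hS hlaw hind (le_max_right _ _) hM0 hs0 hn).trans ?_
    have : ε * B / M = ε ^ 2 / lam := by rw [hM]; field_simp
    rw [this]
    exact union_bound_le hε hδ hδ' hQ.one_le_lam hXc hk hN
  set good := {ω | ∀ (xhat : Fin k → Fin m → ℝ) (f : Fin k → ℝ) (j : Fin k),
    (∀ i, xhat i ∈ Q.X) →
    (∀ i, Q.h (empirical fun n => S i n ω) (xhat i) ≤ β * f i) →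
    (∀ i, f i ≤ ρ * Q.opt (empirical fun n => S i n ω)) →
    (∀ i, f j ≤ f i) →
    Q.h p (xhat j) ≤ 4 * β * ρ * (1 + 0 * ε) * Q.opt p + 2 * β * ρ * κ} with hgood
  have hcover : Set.univ ⊆ good ∪ (bad₁ ∪ bad₂) := by
    intro ω _
    by_contra hω
    simp only [Set.mem_union, not_or] at hω
    obtain ⟨hω, hω₁, hω₂⟩ := hω
    refine hω fun xhat f j hx hf hf' hj => ?_
    have hω₁ : ∃ i, ∑ a, empirical (fun n => S i n ω) a
        * (K + dualLoss Q.dist (Q.g x₀) y₀ a) < (1 + ε) * B := by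
      by_contra! h
      exact hω₁ h
    obtain ⟨i, hi⟩ := hω₁
    have hpi := empirical_mem_stdSimplex hN0 fun n => S i n ω
    have hpj := empirical_mem_stdSimplex hN0 fun n => S j n ω
    rw [hmean _ hpi] at hi
    have h3 : Q.opt (empirical fun n => S i n ω) ≤ (1 + ε) * B := by
      have h4 := DRProblem.opt_le Q (empirical fun n => S i n ω) hx₀
      have h5 := hQ.z_le_dual hpi x₀ hy₀
      unfold DRProblem.h at h4
      linarith
    have h5 : Q.h (empirical fun n => S j n ω) (xhat j) ≤ β * ρ * ((1 + ε) * B) := by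
      calc _ ≤ β * f j := hf j
        _ ≤ β * (ρ * ((1 + ε) * B)) := by
          refine mul_le_mul_of_nonneg_left ?_ (by linarith)
          exact ((hj i).trans (hf' i)).trans (mul_le_mul_of_nonneg_left h3 (by linarith))
        _ = _ := by ring
    have h6 : Q.h p (xhat j) ≤ Q.h (empirical fun n => S j n ω) (xhat j) + 2 * (ε * B) + B + η := by
      refine hQ.h_le_of_lowLoss_le hp hpj (hx j) hy₀ hη0
        (hQ.budget_add_high_le hp hx₀ hy₀ hB0 hε hε' hxy) fun y hy => ?_
      by_contra! h
      exact hω₂ ⟨j, xhat j, hx j, y, hy, h⟩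
    have hβρ : 1 ≤ β * ρ := one_le_mul_of_one_le_of_one_le hβ hρ
    have h7 : 2 * (ε * B) + B + η ≤ β * ρ * (2 * (ε * B) + B + η) :=
      le_mul_of_one_le_left (by positivity) hβρ
    have h8 : β * ρ * ((1 + ε) * B + (2 * (ε * B) + B + η))
        ≤ β * ρ * (4 * Q.opt p + 2 * κ) := by
      refine mul_le_mul_of_nonneg_left ?_ (by linarith)
      have : ε * B ≤ 1 / 3 * B := mul_le_mul_of_nonneg_right hε' hB0.le
      linarith
    linarith
  have h3 : (1 : ℝ) ≤ μ.real good + (μ.real bad₁ + μ.real bad₂) := by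
    calc (1 : ℝ) = μ.real Set.univ := by simp
      _ ≤ μ.real (good ∪ (bad₁ ∪ bad₂)) := measureReal_mono hcover
      _ ≤ _ := (measureReal_union_le _ _).trans
        (add_le_add_right (measureReal_union_le _ _) _)
  linarith
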